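/- Fix constants $a,c\in\mathbb N$. Consider the CONGEST model on an $n$-vertex undirected graph $G=(V,E,w)$ with positive real edge weights, $n\ge 2$, $m=|E|$: in each synchronous round every node may send a (possibly different) message of $O(\log n)$ bits to each of its neighbours; local computation is unrestricted; nodes have private independent fair coins and distinct identifiers in $\{0,\dots,n^a\}$; initially each node knows $n$, the parameters $\ell$ and $W$, its own identifier, and the identifiers of its neighbours together with the weights of the edges to them. A collection of clusters (subsets of $V$) is output by letting every node output the names of the clusters that contain it. For an integer $\ell\ge 1$, a real $W>0$ and a set $L\subseteq\mathbb R$ of lengths, call a finite collection $\mathcal C$ of subsets of $V$ a pairwise cover for the $\ell$-hop paths with length in $L$ if 1. each $C\in\mathcal C$ has strong weighted diameter $O(W\log n)$, i.e. any two vertices of $C$ are joined by a path inside $C$ of weighted length $O(W\log n)$; 2. $\sum_{C\in\mathcal C}|C|=O(n\log n)$ and $\sum_{C\in\mathcal C}|E(C)|=O(m\log n)$, where $E(C)$ is the set of edges with both endpoints in $C$; 3. for every (simple) path $p$ of $G$ with at most $\ell$ edges and weighted length $w(p)\in L$ there is a cluster $C\in\mathcal C$ that contains all vertices of $p$. For $L=(-\infty,W]$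 this is an $\ell$-limited $W$-pairwise cover. **Theorem.** (i) There is a CONGEST algorithm that, for all $n\ge2$, $\ell\ge1$, $W\ge2$ and every such $G$, runs for $O(\ell\log^2 n\,\log W)$ rounds and, with probability at least $1-n^{-c}$, outputs an $\ell$-limited $W$-pairwise cover of $G$. (ii) There is a CONGEST algorithm that, for all $n\ge2$, $\ell\ge1$, $W>0$ and every such $G$, runs for $O(\ell\log^2 n)$ rounds and, with probability at least $1-n^{-c}$, outputs a pairwise cover for the $\ell$-hop paths with length in $[W,2W]$. All constants hidden in the $O$-notation depend only on $a$ and $c$. -/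

import Mathlib

namespace Congest

/-- What a node knows about the graph before the first round: its own identifier and, for each
incident edge, the identifier of the other endpoint together with the weight of the edge. -/
structure LocalInput where
  ident : ℕ
  edges : Set (ℕ × ℝ)

/-- A randomized synchronous message-passing algorithm in which in every round each node sends one
(possibly different) message of `bandwidth` bits to each of its neighbours. All nodes run the same
program. Local computation is unrestricted, each node has `coins` private fair coins, and after
`rounds` rounds each node produces a local output of type `Out`.

Global parameters known to all nodes (such as the number of nodes) are handled by considering
families of such algorithms indexed by these parameters. -/
structure Algorithm (Out : Type) where
  bandwidth : ℕ
  coins : ℕ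
  rounds : ℕ
  State : Type
  /-- initial state, from the local input and the private coins -/
  init : LocalInput → (Fin coins → Bool) → State
  /-- the message for the neighbour that has the given identifier -/
  send : State → ℕ → BitVec bandwidth
  /-- new state, from the set of pairs (identifier of the sender, message) received in a round -/
  receive : State → Set (ℕ × BitVec bandwidth) → State
  output : State → Out

section Execution

variable {n : ℕ} (G : SimpleGraph (Fin n)) (w : Sym2 (Fin n) → ℝ) (ident : Fin n → ℕ)

/-- The local input of the node `v` in the graph `G` with edge weights `w` and identifiers
`ident`. -/
def localInput (v : Fin n) : LocalInput where
  ident := ident v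
  edges := (fun u => (ident u, w s(v, u))) '' G.neighborSet v

/-- An outcome of all the private coins of all the nodes. -/
abbrev Coins {Out : Type} (A : Algorithm Out) (n : ℕ) : Type :=
  Fin n → Fin A.coins → Bool

/-- The state of every node after `t` rounds. -/
def stateAfter {Out : Type} (A : Algorithm Out) (ω : Coins A n) : ℕ → Fin n → A.State
  | 0, v => A.init (localInput G w ident v) (ω v)
  | t + 1, v => A.receive (stateAfter A ω t v)
      ((fun u => (ident u, A.send (stateAfter A ω t u) (ident v))) '' G.neighborSet v)

/-- The outputs of all nodes at the end of the execution. -/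
def run {Out : Type} (A : Algorithm Out) (ω : Coins A n) (v : Fin n) : Out :=
  A.output (stateAfter G w ident A ω A.rounds v)

/-- The probability of an event under independent fair coins. -/
noncomputable def coinProb {Out : Type} (A : Algorithm Out) (n : ℕ) (S : Set (Coins A n)) : ℝ :=
  (ProbabilityTheory.uniformOn (Set.univ : Set (Coins A n))).real S

end Execution

section Covers

variable {n : ℕ} (G : SimpleGraph (Fin n)) (w : Sym2 (Fin n) → ℝ)

/-- The weighted length of a walk. -/
def walkLength {G : SimpleGraph (Fin n)} {u v : Fin n} (p : G.Walk u v) : ℝ :=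
  (p.edges.map w).sum

/-- The (weighted) diameter of the subgraph of `G` induced by `C` is at most `D`
(strong diameter); in particular this subgraph is connected or empty. -/
def StrongDiamLE (C : Set (Fin n)) (D : ℝ) : Prop :=
  ∀ u ∈ C, ∀ v ∈ C, ∃ p : G.Walk u v, (∀ x ∈ p.support, x ∈ C) ∧ walkLength w p ≤ D

/-- The edges of `G` with both endpoints in `C`. -/
def edgesInside (C : Set (Fin n)) : Set (Sym2 (Fin n)) :=
  {e ∈ G.edgeSet | ∀ x ∈ e, x ∈ C}

/-- The clusters `C i`, `i ∈ I`, form a pairwise cover for the paths with at most `ℓ` hops whose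
length lies in `L`: every cluster has diameter at most `D`, the total number of vertices (edges) in
the clusters is at most `S` times the number of vertices (edges) of the graph, and every such path
is contained in some cluster. -/
structure IsPairwiseCover {ι : Type} (ℓ : ℕ) (L : Set ℝ) (D S : ℝ)
    (I : Finset ι) (C : ι → Set (Fin n)) : Prop where
  diam_le : ∀ i ∈ I, StrongDiamLE G w (C i) D
  sum_card_le : ((∑ i ∈ I, (C i).ncard : ℕ) : ℝ) ≤ S * n
  sum_edges_le : ((∑ i ∈ I, (edgesInside G (C i)).ncard : ℕ) : ℝ) ≤ S * G.edgeSet.ncard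
  path_subset : ∀ (u v : Fin n) (p : G.Walk u v), p.IsPath → p.length ≤ ℓ → walkLength w p ∈ L →
    ∃ i ∈ I, ∀ x ∈ p.support, x ∈ C i

/-- If every node outputs the names of the clusters that contain it, these are all the names that
occur. -/
def clusterNames (out : Fin n → Finset ℕ) : Finset ℕ :=
  Finset.univ.biUnion out

/-- If every node outputs the names of the clusters that contain it, this is the cluster with
name `i`. -/
def cluster (out : Fin n → Finset ℕ) (i : ℕ) : Set (Fin n) :=
  {v | i ∈ out v}

/-- The local outputs (names of the clusters that contain the node) describe a pairwise cover. -/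
def OutputsPairwiseCover (ℓ : ℕ) (L : Set ℝ) (D S : ℝ) (out : Fin n → Finset ℕ) : Prop :=
  IsPairwiseCover G w ℓ L D S (clusterNames out) (cluster out)

end Covers

/-- On every `n`-vertex graph with positive edge weights, and for all distinct node identifiers of
size at most `n ^ a`, the algorithm `A` outputs, with probability at least `1 - 1 / n ^ c`, a
pairwise cover for the paths with at most `ℓ` hops whose length lies in `L`, with diameter bound `D`
and overlap bound `S`. -/
def ConstructsCover (A : Algorithm (Finset ℕ)) (a c n ℓ : ℕ) (L : Set ℝ) (D S : ℝ) : Prop :=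
  ∀ (G : SimpleGraph (Fin n)) (w : Sym2 (Fin n) → ℝ) (ident : Fin n → ℕ),
    (∀ e ∈ G.edgeSet, 0 < w e) → Function.Injective ident → (∀ v, ident v ≤ n ^ a) →
    1 - 1 / (n : ℝ) ^ c ≤
      coinProb A n {ω | OutputsPairwiseCover G w ℓ L D S (run G w ident A ω)}

end Congest

/-! The cover is a union of independent clusterings with random head starts. Weights are rounded up
to multiples of `δ = W / min ℓ n`, so a simple path with at most `ℓ` edges and length at most `W`
has at most `2 * min ℓ n` units. In each phase every vertex draws a truncated geometric head start,
scaled by some `R > 4 * min ℓ n`. Values decay by one per unit along edges, and a vertex joins the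
source of the largest value that reaches it. The identifier, a low-order digit in base `B`, breaks
ties and names the cluster.

Head starts are `O(ℓ log n)` units. This bounds the cluster radius by `O(W log n)`
(`IsEnvelope.strongDiamLE`) and the length of a phase (`isEnvelope_spread`).

For the padding, give the source of `v` one more head. Its head start grows by `R` units, so it wins
everywhere within distance `R / 2` of `v` (`IsEnvelope.mod_eq_of_raised`). The change can be undone
from the dropped coin and the source, which is still visible as the new cluster of `v`. Hence it is
at most two-to-one (`card_forall_leadingHeads_le`), and `v` is padded with probability at least `1 /
4`. After `O(log n)` phases every vertex has been padded with high probability, and a path lies in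
the cluster of its first vertex in a phase that pads this vertex.

All lengths up to `W` are treated at once, so no factor `log W` arises, and the window `[W, 2W]` is
covered by the same construction for `2W`. -/

namespace Congest

/-! ### Envelopes of decaying values and their computation by synchronous relaxation. -/

section Spread

variable {V : Type*} {G : SimpleGraph V} {k : Sym2 V → ℕ} {B : ℕ} {a f : V → ℕ}

/-- The total weight of the edges of a walk, for integer edge weights. -/
def walkUnits (k : Sym2 V → ℕ) {u v : V} (p : G.Walk u v) : ℕ :=
  (p.edges.map k).sum

@[simp] lemma walkUnits_nil (u : V) : walkUnits k (SimpleGraph.Walk.nil : G.Walk u u) = 0 := rfl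

@[simp] lemma walkUnits_cons {u v x : V} (h : G.Adj u v) (p : G.Walk v x) :
    walkUnits k (SimpleGraph.Walk.cons h p) = k s(u, v) + walkUnits k p := by
  simp [walkUnits]

/-- `f` is the upper envelope of the values `a` decreasing at rate `B` along the edges, truncated
at `0`: it dominates `a`, changes by at most `k e * B` along every edge `e`, and every value is
either the initial one or inherited from a neighbour. -/
structure IsEnvelope (G : SimpleGraph V) (k : Sym2 V → ℕ) (B : ℕ) (a f : V → ℕ) : Prop where
  le : ∀ v, a v ≤ f v
  adj_le : ∀ v u, G.Adj v u → f u ≤ f v + k s(v, u) * B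
  attained : ∀ v, f v = a v ∨ ∃ u, G.Adj v u ∧ f u = f v + k s(v, u) * B

namespace IsEnvelope

lemma walk_le (h : IsEnvelope G k B a f) {u v : V} (p : G.Walk u v) :
    f v ≤ f u + walkUnits k p * B := by
  induction p with
  | nil => simp
  | cons hadj p ih =>
    have := h.adj_le _ _ hadj
    rw [walkUnits_cons, add_mul]
    omega

lemma le_walk (h : IsEnvelope G k B a f) {u v : V} (p : G.Walk u v) :
    f u ≤ f v + walkUnits k p * B := by
  induction p with
  | nil => simp
  | @cons x y z hadj p ih =>
    have := h.adj_le _ _ hadj.symm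
    rw [walkUnits_cons, add_mul, Sym2.eq_swap]
    omega

/-- Every value of the envelope stems from a source `z`, along a walk on which all values are
congruent modulo `B`. -/
lemma exists_source [Finite V] (h : IsEnvelope G k B a f) (hB : 0 < B)
    (hk : ∀ e ∈ G.edgeSet, 0 < k e) (v : V) :
    ∃ (z : V) (p : G.Walk v z), a z = f v + walkUnits k p * B ∧
      ∀ x ∈ p.support, f x % B = a z % B := by
  obtain ⟨A, hA⟩ := (Set.finite_range f).bddAbove
  have hA' : ∀ v, f v ≤ A := fun v => hA ⟨v, rfl⟩
  -- Following the neighbours that attain the value strictly increases the bounded function `f`.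
  induction hm : A - f v using Nat.strong_induction_on generalizing v with
  | _ m ih =>
    rcases h.attained v with hv | ⟨u, hadj, hu⟩
    · exact ⟨v, .nil, by simp [hv], by simp [hv]⟩
    · have hpos : 0 < k s(v, u) * B := Nat.mul_pos (hk _ hadj) hB
      have h1 := hA' u
      obtain ⟨z, p, hz, hp⟩ := ih (A - f u) (by omega) u rfl
      refine ⟨z, .cons hadj p, by rw [hz, hu, walkUnits_cons]; ring, ?_⟩
      intro x hx
      rw [SimpleGraph.Walk.support_cons, List.mem_cons] at hx
      rcases hx with rfl | hx
      · rw [← hp u p.start_mem_support, hu, Nat.add_mul_mod_self_right]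
      · exact hp x hx

/-- If the source of the value at `v` is raised by `R * B`, it becomes the source of the values at
all vertices at distance less than `R / 2` from `v`. -/
lemma mod_eq_of_raised [Finite V] [DecidableEq V] (h : IsEnvelope G k B a f) (hB : 0 < B)
    (hk : ∀ e ∈ G.edgeSet, 0 < k e) {v z : V} (p : G.Walk v z)
    (hz : a z = f v + walkUnits k p * B) {R : ℕ} {f' : V → ℕ}
    (h' : IsEnvelope G k B (Function.update a z (a z + R * B)) f') {y : V} (q : G.Walk v y)
    (hq : 2 * walkUnits k q < R) : f' y % B = a z % B := by
  obtain ⟨z', p', hz', hp'⟩ := h'.exists_source hB hk y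
  have hy := hp' y p'.start_mem_support
  by_cases hzz : z' = z
  · subst hzz
    rw [hy, Function.update_self, Nat.add_mul_mod_self_right]
  -- The source `z'` was not raised, so `f' y ≤ f y ≤ f v + |q| * B`, with `|q|` the units of `q`.
  -- The raised `z` forces `f' v ≥ f v + R * B`, and `f' y ≥ f' v - |q| * B`. Together `R ≤ 2 *
  -- |q|`.
  · exfalso
    rw [Function.update_of_ne hzz] at hz'
    have h1 := h.walk_le p'
    have h2 := h.le z'
    have h3 := h.walk_le q
    have h4 := h'.le_walk q
    have h5 := h'.walk_le p
    have h6 := h'.le z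
    rw [Function.update_self] at h6
    have h7 : R * B ≤ (2 * walkUnits k q) * B := by
      rw [mul_assoc, two_mul]; omega
    have := Nat.le_of_mul_le_mul_right h7 hB
    omega

end IsEnvelope

variable [Finite V]

/-- One synchronous step towards the envelope of `a`. -/
noncomputable def relax (G : SimpleGraph V) (k : Sym2 V → ℕ) (B : ℕ) (a f : V → ℕ) (v : V) : ℕ :=
  sSup (insert (a v) ((fun u => f u - k s(v, u) * B) '' G.neighborSet v))

/-- The values after `t` synchronous steps towards the envelope of `a`. -/
noncomputable def spread (G : SimpleGraph V) (k : Sym2 V → ℕ) (B : ℕ) (a : V → ℕ) : ℕ → V → ℕ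
  | 0 => a
  | t + 1 => relax G k B a (spread G k B a t)

lemma bddAbove_relax (v : V) :
    BddAbove (insert (a v) ((fun u => f u - k s(v, u) * B) '' G.neighborSet v)) :=
  (((Set.toFinite _).image _).insert _).bddAbove

lemma le_relax (v : V) : a v ≤ relax G k B a f v :=
  le_csSup (bddAbove_relax v) (Set.mem_insert _ _)

lemma adj_le_relax {v u : V} (h : G.Adj v u) : f u ≤ relax G k B a f v + k s(v, u) * B := by
  rw [← Nat.sub_le_iff_le_add]
  exact le_csSup (bddAbove_relax v) (Set.mem_insert_of_mem _ ⟨u, h, rfl⟩)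

lemma relax_eq (v : V) : relax G k B a f v = a v ∨
    ∃ u, G.Adj v u ∧ relax G k B a f v = f u - k s(v, u) * B := by
  have := Nat.sSup_mem (Set.insert_nonempty _ _) (bddAbove_relax (G := G) (k := k) (B := B)
    (a := a) (f := f) v)
  rcases this with h | ⟨u, hu, h⟩
  · exact .inl h
  · exact .inr ⟨u, hu, h.symm⟩

lemma relax_mono {f g : V → ℕ} (h : f ≤ g) : relax G k B a f ≤ relax G k B a g := by
  intro v
  rcases relax_eq (G := G) (k := k) (B := B) (a := a) (f := f) v with hv | ⟨u, hu, hv⟩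
  · rw [hv]; exact le_relax v
  · have := adj_le_relax (k := k) (B := B) (a := a) (f := g) hu
    have : f u ≤ g u := h u
    change relax G k B a f v ≤ relax G k B a g v
    omega

lemma spread_le_succ (t : ℕ) : spread G k B a t ≤ spread G k B a (t + 1) := by
  induction t with
  | zero => exact fun v => le_relax v
  | succ t ih => exact relax_mono ih

lemma spread_le {A : ℕ} (hA : ∀ v, a v ≤ A) (t : ℕ) (v : V) : spread G k B a t v ≤ A := by
  induction t generalizing v with
  | zero => exact hA v
  | succ t ih =>
    rcases relax_eq (G := G) (k := k) (B := B) (a := a) (f := spread G k B a t) v with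
      hv | ⟨u, hu, hv⟩
    · rw [spread, hv]; exact hA v
    · rw [spread, hv]; exact (Nat.sub_le _ _).trans (ih u)

/-- A value that changes in step `t + 1` has travelled over `t + 1` edges. -/
lemma spread_succ_add_le (hk : ∀ e ∈ G.edgeSet, 0 < k e) {A : ℕ} (hA : ∀ v, a v ≤ A) (t : ℕ)
    (v : V) (h : spread G k B a (t + 1) v ≠ spread G k B a t v) :
    spread G k B a (t + 1) v + (t + 1) * B ≤ A := by
  induction t generalizing v with
  | zero =>
    rcases relax_eq (G := G) (k := k) (B := B) (a := a) (f := a) v with hv | ⟨u, hu, hv⟩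
    · exact absurd hv h
    · have h1 : a v ≤ relax G k B a a v := le_relax v
      have h2 : B ≤ k s(v, u) * B := Nat.le_mul_of_pos_left _ (hk _ hu)
      have h3 := hA u
      change relax G k B a a v ≠ a v at h
      change relax G k B a a v + (0 + 1) * B ≤ A
      rw [zero_add, one_mul]
      omega
  | succ t ih =>
    have h1 : spread G k B a (t + 1) v ≤ spread G k B a (t + 1 + 1) v := spread_le_succ (t + 1) v
    have h0 : a v ≤ spread G k B a (t + 1) v := le_relax v
    rcases relax_eq (G := G) (k := k) (B := B) (a := a) (f := spread G k B a (t + 1)) v with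
      hv | ⟨u, hu, hv⟩
    · change spread G k B a (t + 1 + 1) v = _ at hv
      omega
    · change spread G k B a (t + 1 + 1) v = _ at hv
      have h2 : B ≤ k s(v, u) * B := Nat.le_mul_of_pos_left _ (hk _ hu)
      have h3 := adj_le_relax (k := k) (B := B) (a := a) (f := spread G k B a t) hu
      change _ ≤ spread G k B a (t + 1) v + _ at h3
      -- The neighbour `u` must have changed in the previous step, since otherwise `v` would already
      -- have had its new value.
      have h4 := ih u (by omega)
      rw [add_mul (t + 1) 1 B, one_mul]
      omega

/-- If all initial values are less than `Q * B`, the envelope is reached after `Q` steps. -/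
lemma isEnvelope_spread (hk : ∀ e ∈ G.edgeSet, 0 < k e) {Q : ℕ} (hQ : ∀ v, a v < Q * B) :
    IsEnvelope G k B a (spread G k B a Q) := by
  have hfix : relax G k B a (spread G k B a Q) = spread G k B a Q := by
    funext v
    by_contra h
    have h1 := spread_succ_add_le hk (A := Q * B - 1) (fun v => by have := hQ v; omega) Q v h
    have h2 := hQ v
    rw [add_mul] at h1
    omega
  constructor
  · intro v
    rw [← hfix]
    exact le_relax v
  · intro v u h
    nth_rw 2 [← hfix]
    exact adj_le_relax h
  · intro v
    have h0 : a v ≤ spread G k B a Q v := by rw [← hfix]; exact le_relax v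
    rcases relax_eq (G := G) (k := k) (B := B) (a := a) (f := spread G k B a Q) v with
      hv | ⟨u, hu, hv⟩
    · exact .inl (by rw [hfix] at hv; exact hv)
    · rw [hfix] at hv
      -- Truncated subtraction loses the exact equation only at value `0`, and there the initial
      -- value is `0` too.
      by_cases hz : spread G k B a Q v = 0
      · left; omega
      · exact .inr ⟨u, hu, by omega⟩

end Spread

/-! ### Truncated geometric variables from fair coins. -/

/-- The number of leading heads in a sequence of coin flips. -/
def leadingHeads : {m : ℕ} → (Fin m → Bool) → ℕ
  | 0, _ => 0
  | _ + 1, x => if x 0 then leadingHeads (Fin.tail x) + 1 else 0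

lemma leadingHeads_le {m : ℕ} (x : Fin m → Bool) : leadingHeads x ≤ m := by
  induction m with
  | zero => simp [leadingHeads]
  | succ m ih =>
    rw [leadingHeads]
    split_ifs
    · have := ih (Fin.tail x); omega
    · omega

lemma leadingHeads_eq_iff {m : ℕ} (x : Fin m → Bool) :
    leadingHeads x = m ↔ x = fun _ => true := by
  induction m with
  | zero => exact iff_of_true rfl (Subsingleton.elim _ _)
  | succ m ih =>
    rw [leadingHeads]
    constructor
    · split_ifs with h
      · intro h'
        have h2 := (ih (Fin.tail x)).1 (by omega)
        funext j
        refine Fin.cases h (fun j => ?_) j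
        exact congrFun h2 j
      · exact False.elim
    · rintro rfl
      have h2 : leadingHeads (Fin.tail fun _ : Fin (m + 1) => true) = m := (ih _).2 rfl
      simpa using h2

lemma leadingHeads_init {m : ℕ} (x : Fin (m + 1) → Bool) (h : leadingHeads x ≤ m) :
    leadingHeads (Fin.init x) = leadingHeads x := by
  induction m with
  | zero =>
    have : leadingHeads x = 0 := by omega
    rw [this]; rfl
  | succ m ih =>
    have h0 : Fin.init x 0 = x 0 := rfl
    rw [leadingHeads, h0, leadingHeads]
    rw [leadingHeads] at h
    split_ifs at h ⊢ with hx
    · rw [← ih (Fin.tail x) (by omega)]; rfl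
    · rfl

/-- Prepend heads and drop the last coin. -/
def pushHeads {m : ℕ} (x : Fin (m + 1) → Bool) : Fin (m + 1) → Bool :=
  Fin.cons (α := fun _ => Bool) true (Fin.init x)

lemma leadingHeads_pushHeads {m : ℕ} (x : Fin (m + 1) → Bool) (h : leadingHeads x ≤ m) :
    leadingHeads (pushHeads x) = leadingHeads x + 1 := by
  rw [leadingHeads]
  simp [pushHeads, leadingHeads_init x h]

/-- The dropped coin is the only information lost, which makes `pushHeads` at most two-to-one. -/
lemma pushHeads_injective {m : ℕ} {x y : Fin (m + 1) → Bool} (h : pushHeads x = pushHeads y)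
    (hlast : x (Fin.last m) = y (Fin.last m)) : x = y := by
  have h1 : Fin.init x = Fin.init y := by
    have := congrArg Fin.tail h
    simpa [pushHeads] using this
  rw [← Fin.snoc_init_self x, ← Fin.snoc_init_self y, h1, hlast]

/-! ### Keys combining head start and identifier. -/

section Keys

variable {V : Type*} {B R m : ℕ} {ident : V → ℕ}

/-- The initial keys: `R` times the number of leading heads as the high-order digit, the
identifier as the low-order digit. -/
def initialKey (R B : ℕ) (ident : V → ℕ) {m : ℕ} (ω : V → Fin m → Bool) (v : V) : ℕ :=
  R * leadingHeads (ω v) * B + ident v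

lemma initialKey_mod (hident : ∀ v, ident v < B) (ω : V → Fin m → Bool) (v : V) :
    initialKey R B ident ω v % B = ident v := by
  rw [initialKey, Nat.mul_add_mod_self_right, Nat.mod_eq_of_lt (hident v)]

/-- Translates a change of coins into the raise by `R * B` required by
`IsEnvelope.mod_eq_of_raised`. -/
lemma initialKey_update [DecidableEq V] (ω : V → Fin (m + 1) → Bool) (z : V)
    (h : leadingHeads (ω z) ≤ m) :
    initialKey R B ident (Function.update ω z (pushHeads (ω z))) =
      Function.update (initialKey R B ident ω) z (initialKey R B ident ω z + R * B) := by
  funext x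
  by_cases hx : x = z
  · subst hx
    simp only [initialKey, Function.update_self, leadingHeads_pushHeads _ h]
    ring
  · simp [initialKey, Function.update_of_ne hx]

/-- All vertices at distance less than `R / 2` from `v` have values congruent to that of `v`. -/
def Padded (G : SimpleGraph V) (k : Sym2 V → ℕ) (B R : ℕ) (f : V → ℕ) (v : V) : Prop :=
  ∀ (y : V) (q : G.Walk v y), 2 * walkUnits k q < R → f y % B = f v % B

end Keys

/-! ### The padding probability, by counting coin outcomes. -/

section Counting

variable {V : Type*} [Fintype V] [DecidableEq V]

open Finset Classical

/-- A union bound over the vertices. For fixed `u`, overwriting the all-heads coins of `u` by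
arbitrary ones is injective. -/
lemma card_exists_leadingHeads_eq_le {m : ℕ} :
    #{ω : V → Fin m → Bool | ∃ u, leadingHeads (ω u) = m} * 2 ^ m ≤
      Fintype.card V * Fintype.card (V → Fin m → Bool) := by
  have hu : ∀ u : V, #{ω : V → Fin m → Bool | leadingHeads (ω u) = m} * 2 ^ m ≤
      Fintype.card (V → Fin m → Bool) := by
    intro u
    have h2 : 2 ^ m = #(univ : Finset (Fin m → Bool)) := by simp
    rw [h2, ← card_product, ← card_univ (α := V → Fin m → Bool)]
    refine card_le_card_of_injOn (fun q => Function.update q.1 u q.2) (by simp) ?_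
    rintro ⟨ω, y⟩ h ⟨ω', y'⟩ h' heq
    simp only [coe_product, coe_filter, mem_univ, true_and, Set.mem_prod, Set.mem_ofPred_eq,
      coe_univ, Set.mem_univ, and_true, leadingHeads_eq_iff] at h h' heq
    have hy : y = y' := by simpa using congrFun heq u
    refine Prod.ext (funext fun x => ?_) hy
    by_cases hx : x = u
    · subst hx; exact h.trans h'.symm
    · simpa [Function.update_of_ne hx] using congrFun heq x
  calc #{ω : V → Fin m → Bool | ∃ u, leadingHeads (ω u) = m} * 2 ^ m
      ≤ (∑ u : V, #{ω : V → Fin m → Bool | leadingHeads (ω u) = m}) * 2 ^ m := by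
        gcongr
        refine (card_le_card ?_).trans card_biUnion_le
        intro ω
        simp
    _ = ∑ u : V, #{ω : V → Fin m → Bool | leadingHeads (ω u) = m} * 2 ^ m := sum_mul _ _ _
    _ ≤ ∑ u : V, Fintype.card (V → Fin m → Bool) := sum_le_sum fun u _ => hu u
    _ = _ := by simp

variable {G : SimpleGraph V} {k : Sym2 V → ℕ} {B R m : ℕ} {ident : V → ℕ}

/-- At least half of the coin outcomes without extreme values correspond to outcomes for which
`v` is padded. -/
lemma card_forall_leadingHeads_le (hB : 0 < B) (hR : 0 < R) (hk : ∀ e ∈ G.edgeSet, 0 < k e)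
    (hinj : Function.Injective ident) (hident : ∀ v, ident v < B)
    (f : (V → Fin (m + 1) → Bool) → V → ℕ)
    (hf : ∀ ω, IsEnvelope G k B (initialKey R B ident ω) (f ω)) (v : V) :
    #{ω : V → Fin (m + 1) → Bool | ∀ u, leadingHeads (ω u) ≤ m} ≤
      #{ω | Padded G k B R (f ω) v} * 2 := by
  choose z p hz _ using fun ω => (hf ω).exists_source hB hk v
  let φ : (V → Fin (m + 1) → Bool) → V → Fin (m + 1) → Bool :=
    fun ω => Function.update ω (z ω) (pushHeads (ω (z ω)))
  have key : ∀ ω, (∀ u, leadingHeads (ω u) ≤ m) → ∀ (y : V) (q : G.Walk v y),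
      2 * walkUnits k q < R → f (φ ω) y % B = ident (z ω) := by
    intro ω hω y q hq
    have h' := hf (φ ω)
    rw [initialKey_update ω (z ω) (hω _)] at h'
    rw [(hf ω).mod_eq_of_raised hB hk (p ω) (hz ω) h' q hq, initialKey_mod hident]
  have h2 : 2 = #(univ : Finset Bool) := by simp
  rw [h2, ← card_product]
  -- The Boolean component stores the coin dropped by `pushHeads`.
  refine card_le_card_of_injOn (fun ω => (φ ω, ω (z ω) (Fin.last m))) ?_ ?_
  · intro ω hω
    simp only [coe_filter, mem_univ, true_and, Set.mem_ofPred_eq] at hω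
    simp only [coe_product, coe_filter, mem_univ, true_and, Set.mem_prod, Set.mem_ofPred_eq,
      coe_univ, Set.mem_univ, and_true]
    intro y q hq
    rw [key ω hω y q hq, key ω hω v .nil (by simpa using hR)]
  · intro ω hω ω' hω' heq
    simp only [coe_filter, mem_univ, true_and, Set.mem_ofPred_eq] at hω hω'
    obtain ⟨hφ, hlast⟩ := Prod.ext_iff.1 heq
    simp only at hφ hlast
    -- The modified vertex is recovered from `φ ω` alone: its identifier is the low-order digit at
    -- `v`.
    have hzz : z ω = z ω' := hinj <| by
      rw [← key ω hω v .nil (by simpa using hR), hφ, key ω' hω' v .nil (by simpa using hR)]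
    funext x
    have hx := congrFun hφ x
    simp only [φ, ← hzz] at hx
    by_cases hxz : x = z ω
    · subst hxz
      simp only [Function.update_self] at hx
      rw [← hzz] at hlast
      exact pushHeads_injective hx hlast
    · simpa [Function.update_of_ne hxz] using hx

/-- A vertex fails to be padded with probability at most `3 / 4`. -/
lemma card_not_padded_le (hB : 0 < B) (hR : 0 < R) (hk : ∀ e ∈ G.edgeSet, 0 < k e)
    (hinj : Function.Injective ident) (hident : ∀ v, ident v < B)
    (hm : Fintype.card V ≤ 2 ^ m) (f : (V → Fin (m + 1) → Bool) → V → ℕ)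
    (hf : ∀ ω, IsEnvelope G k B (initialKey R B ident ω) (f ω)) (v : V) :
    4 * #{ω | ¬ Padded G k B R (f ω) v} ≤ 3 * Fintype.card (V → Fin (m + 1) → Bool) := by
  have h1 := card_forall_leadingHeads_le hB hR hk hinj hident f hf v
  have h2 := card_exists_leadingHeads_eq_le (V := V) (m := m + 1)
  have h3 := card_filter_add_card_filter_not (s := (univ : Finset (V → Fin (m + 1) → Bool)))
    (fun ω => Padded G k B R (f ω) v)
  have h4 := card_filter_add_card_filter_not (s := (univ : Finset (V → Fin (m + 1) → Bool)))
    (fun ω => ∃ u, leadingHeads (ω u) = m + 1)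
  have h5 : #{ω : V → Fin (m + 1) → Bool | ¬ ∃ u, leadingHeads (ω u) = m + 1} ≤
      #{ω : V → Fin (m + 1) → Bool | ∀ u, leadingHeads (ω u) ≤ m} := by
    refine card_le_card fun ω => ?_
    simp only [mem_filter, mem_univ, true_and]
    intro h u
    have := leadingHeads_le (ω u)
    have : leadingHeads (ω u) ≠ m + 1 := fun h' => h ⟨u, h'⟩
    omega
  rw [card_univ] at h3 h4
  -- With `m + 1` coins per vertex extreme outcomes have probability at most `1 / 2`. At least half
  -- as many outcomes as the remaining ones are padded, hence a fraction of at least `1 / 4`.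
  have h6 : 2 * #{ω : V → Fin (m + 1) → Bool | ∃ u, leadingHeads (ω u) = m + 1} ≤
      Fintype.card (V → Fin (m + 1) → Bool) := by
    have h7 := h2.trans (Nat.mul_le_mul_right _ hm)
    refine Nat.le_of_mul_le_mul_left ?_ (show 0 < 2 ^ m by positivity)
    rw [pow_succ] at h7
    linarith
  omega

end Counting

/-! ### The distributed algorithm and its execution. -/

/-- The state of a node in `coverAlgorithm`: its input, the number of the current round, and for
each of the `T` phases the current key. -/
structure NodeState (T m : ℕ) where
  input : LocalInput
  coins : Fin (T * m) → Bool
  time : ℕ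
  keys : Fin T → ℕ

/-- The coins that are used in phase `i`. -/
def phaseCoins {T m : ℕ} (x : Fin (T * m) → Bool) (i : Fin T) : Fin m → Bool :=
  fun j => x (finProdFinEquiv (i, j))

/-- In each of `T` phases of `R * m + 1` rounds, the nodes compute the envelope of random initial
keys with respect to the edge weights rounded by `r`. The name of the cluster of a node is given by
the phase and the low-order digit of the key, which is the identifier of the source of the key. -/
noncomputable def coverAlgorithm (b T m R B : ℕ) (r : ℝ → ℕ) : Algorithm (Finset ℕ) where
  bandwidth := b
  coins := T * m
  rounds := T * (R * m + 1)
  State := NodeState T m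
  init inp x := ⟨inp, x, 0, fun i => R * leadingHeads (phaseCoins x i) * B + inp.ident⟩
  send s _ := BitVec.ofNat b (if h : s.time / (R * m + 1) < T then s.keys ⟨_, h⟩ else 0)
  receive s S := ⟨s.input, s.coins, s.time + 1, fun i =>
    if (i : ℕ) = s.time / (R * m + 1) then
      sSup (insert (R * leadingHeads (phaseCoins s.coins i) * B + s.input.ident)
        {x | ∃ q ∈ S, ∃ y, (q.1, y) ∈ s.input.edges ∧ q.2.toNat - r y * B = x})
    else s.keys i⟩
  output s := Finset.univ.image fun i : Fin T => Nat.pair i (s.keys i % B)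

section

variable {n : ℕ} (G : SimpleGraph (Fin n)) (w : Sym2 (Fin n) → ℝ) (ident : Fin n → ℕ)
  {b T m R B : ℕ} (r : ℝ → ℕ)

lemma initialKey_lt (hident : ∀ v, ident v < B) (ω : Fin n → Fin m → Bool) (v : Fin n) :
    initialKey R B ident ω v < (R * m + 1) * B := by
  have h1 : R * leadingHeads (ω v) * B ≤ R * m * B := by
    gcongr
    exact leadingHeads_le _
  have h2 := hident v
  rw [initialKey, add_mul, one_mul]
  omega

/-- The keys of phase `i` after `t` steps of this phase. -/
noncomputable def phaseKeys (R B : ℕ) (ω : Fin n → Fin (T * m) → Bool) (i : Fin T) (t : ℕ) :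
    Fin n → ℕ :=
  spread G (fun e => r (w e)) B (initialKey R B ident fun v => phaseCoins (ω v) i) t

lemma phaseKeys_lt (hident : ∀ v, ident v < B) (hb : (R * m + 1) * B ≤ 2 ^ b)
    (ω : Fin n → Fin (T * m) → Bool) (i : Fin T) (t : ℕ) (v : Fin n) :
    phaseKeys G w ident r R B ω i t v < 2 ^ b := by
  have hpos : 0 < 2 ^ b := by positivity
  have := spread_le (G := G) (k := fun e => r (w e)) (B := B)
    (a := initialKey R B ident fun v => phaseCoins (ω v) i) (A := 2 ^ b - 1)
    (fun v => by
      have := initialKey_lt (m := m) (R := R) ident hident (fun v => phaseCoins (ω v) i) v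
      omega) t v
  rw [phaseKeys]
  omega

/-- Phase `i` occupies the `R * m + 1` rounds starting at time `i * (R * m + 1)`. Truncated
subtraction and `min` keep its keys fixed before and after. -/
lemma stateAfter_coverAlgorithm (hinj : Function.Injective ident) (hident : ∀ v, ident v < B)
    (hb : (R * m + 1) * B ≤ 2 ^ b) (ω : Fin n → Fin (T * m) → Bool) (t : ℕ) (v : Fin n) :
    stateAfter G w ident (coverAlgorithm b T m R B r) ω t v =
      (⟨localInput G w ident v, ω v, t, fun i => phaseKeys G w ident r R B ω i
        (min (t - i * (R * m + 1)) (R * m + 1)) v⟩ : NodeState T m) := by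
  induction t generalizing v with
  | zero =>
    simp only [Nat.zero_sub, Nat.zero_min]
    rfl
  | succ t ih =>
    set Q := R * m + 1 with hQ
    have hQpos : 0 < Q := by omega
    change (coverAlgorithm b T m R B r).receive
      (stateAfter G w ident (coverAlgorithm b T m R B r) ω t v)
      ((fun u => (ident u, (coverAlgorithm b T m R B r).send
        (stateAfter G w ident (coverAlgorithm b T m R B r) ω t u) (ident v))) ''
          G.neighborSet v) = _
    simp only [ih]
    simp only [coverAlgorithm, ← hQ]
    congr 1
    funext i
    have hdiv := Nat.div_add_mod t Q
    have hmod := Nat.mod_lt t hQpos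
    rw [mul_comm] at hdiv
    by_cases hi : (i : ℕ) = t / Q
    · rw [if_pos hi]
      have hlt : t / Q < T := hi ▸ i.2
      have hi' : i = ⟨t / Q, hlt⟩ := Fin.ext hi
      subst hi'
      have e1 : min (t - t / Q * Q) Q = t % Q := by omega
      have e2 : min (t + 1 - t / Q * Q) Q = t % Q + 1 := by omega
      simp only [e2, e1]
      rw [phaseKeys, spread, relax]
      congr 1
      congr 1
      ext x
      constructor
      · rintro ⟨_, ⟨u, hu, rfl⟩, y, ⟨u', hu', he⟩, rfl⟩
        simp only [Prod.mk.injEq] at he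
        obtain ⟨he1, rfl⟩ := he
        -- Distinct identifiers ensure that the weight looked up in the input belongs to the edge to
        -- the sender.
        obtain rfl := hinj he1
        refine ⟨u', hu', ?_⟩
        simp only [hlt, dif_pos, BitVec.toNat_ofNat]
        rw [Nat.mod_eq_of_lt (phaseKeys_lt G w ident r hident hb ω _ _ _)]
        rfl
      · rintro ⟨u, hu, rfl⟩
        refine ⟨_, ⟨u, hu, rfl⟩, w s(v, u), ⟨u, hu, rfl⟩, ?_⟩
        simp only [hlt, dif_pos, BitVec.toNat_ofNat]
        rw [Nat.mod_eq_of_lt (phaseKeys_lt G w ident r hident hb ω _ _ _)]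
        rfl
    · rw [if_neg hi]
      congr 1
      rcases Nat.lt_or_gt_of_ne hi with h | h
      · have := Nat.mul_le_mul_right Q (Nat.succ_le_of_lt h)
        rw [Nat.succ_mul] at this
        omega
      · have := Nat.mul_le_mul_right Q (Nat.succ_le_of_lt h)
        rw [Nat.succ_mul] at this
        omega

lemma run_coverAlgorithm (hinj : Function.Injective ident) (hident : ∀ v, ident v < B)
    (hb : (R * m + 1) * B ≤ 2 ^ b) (ω : Fin n → Fin (T * m) → Bool) (v : Fin n) :
    run G w ident (coverAlgorithm b T m R B r) ω v = Finset.univ.image fun i : Fin T =>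
      Nat.pair i (phaseKeys G w ident r R B ω i (R * m + 1) v % B) := by
  change (coverAlgorithm b T m R B r).output (stateAfter G w ident (coverAlgorithm b T m R B r) ω
    (T * (R * m + 1)) v) = _
  rw [stateAfter_coverAlgorithm G w ident r hinj hident hb]
  simp only [coverAlgorithm]
  refine Finset.image_congr fun i _ => ?_
  have := Nat.mul_le_mul_right (R * m + 1) (Nat.succ_le_of_lt i.2)
  rw [Nat.succ_mul] at this
  rw [min_eq_right (by omega)]

end

/-! ### From padded envelopes to covers, with rounded weights. -/

section

variable {n : ℕ} {G : SimpleGraph (Fin n)} {w : Sym2 (Fin n) → ℝ} {k : Sym2 (Fin n) → ℕ}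
  {ident : Fin n → ℕ}

lemma walkLength_le {δ : ℝ} (h : ∀ e ∈ G.edgeSet, w e ≤ k e * δ) {u v : Fin n} (p : G.Walk u v) :
    walkLength w p ≤ walkUnits k p * δ := by
  induction p with
  | nil => simp [walkLength]
  | cons hadj p ih =>
    have h1 := h _ ((SimpleGraph.mem_edgeSet G).2 hadj)
    simp only [walkLength, SimpleGraph.Walk.edges_cons, List.map_cons, List.sum_cons,
      walkUnits_cons, Nat.cast_add] at ih ⊢
    linarith

lemma walkUnits_le {δ : ℝ} (h : ∀ e ∈ G.edgeSet, k e * δ ≤ w e + δ) {u v : Fin n}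
    (p : G.Walk u v) : walkUnits k p * δ ≤ walkLength w p + p.length * δ := by
  induction p with
  | nil => simp [walkLength]
  | cons hadj p ih =>
    have h1 := h _ ((SimpleGraph.mem_edgeSet G).2 hadj)
    simp only [walkLength, SimpleGraph.Walk.edges_cons, List.map_cons, List.sum_cons,
      walkUnits_cons, Nat.cast_add, SimpleGraph.Walk.length_cons, Nat.cast_one] at ih ⊢
    linarith

lemma walkUnits_append {u v x : Fin n} (p : G.Walk u v) (q : G.Walk v x) :
    walkUnits k (p.append q) = walkUnits k p + walkUnits k q := by
  simp [walkUnits, SimpleGraph.Walk.edges_append]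

lemma walkUnits_reverse {u v : Fin n} (p : G.Walk u v) :
    walkUnits k p.reverse = walkUnits k p := by
  simp [walkUnits, SimpleGraph.Walk.edges_reverse, List.sum_reverse]

lemma walkUnits_takeUntil_le {u v x : Fin n} (p : G.Walk u v) (h : x ∈ p.support) :
    walkUnits k (p.takeUntil x h) ≤ walkUnits k p := by
  conv_rhs => rw [← p.take_spec h, walkUnits_append]
  omega

/-- The residue determines the source, so two vertices of a cluster are joined through their common
source by walks inside the cluster. Each unit costs `B`, so each of the two walks has at most `Q`
units. -/
lemma IsEnvelope.strongDiamLE {B Q s : ℕ} {a f : Fin n → ℕ} {δ : ℝ}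
    (hf : IsEnvelope G k B a f) (hk : ∀ e ∈ G.edgeSet, 0 < k e) (hB : 0 < B)
    (hinj : Function.Injective ident) (ha : ∀ v, a v % B = ident v)
    (hQ : ∀ v, a v < (Q + 1) * B) (hδ : 0 ≤ δ) (h : ∀ e ∈ G.edgeSet, w e ≤ k e * δ) :
    StrongDiamLE G w {v | f v % B = s} (2 * Q * δ) := by
  intro u hu v hv
  obtain ⟨x, p, hx, hp⟩ := hf.exists_source hB hk u
  obtain ⟨y, q, hy, hq⟩ := hf.exists_source hB hk v
  have hxs : a x % B = s := by rw [← hp u p.start_mem_support]; exact hu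
  have hys : a y % B = s := by rw [← hq v q.start_mem_support]; exact hv
  obtain rfl : x = y := hinj (by rw [← ha, ← ha, hxs, hys])
  have bound : ∀ c d : ℕ, a x = c + d * B → d ≤ Q := by
    intro c d hcd
    have h1 := hQ x
    have h2 : d * B < (Q + 1) * B := by omega
    have := Nat.lt_of_mul_lt_mul_right h2
    omega
  refine ⟨p.append q.reverse, ?_, ?_⟩
  · intro y hy
    rw [SimpleGraph.Walk.mem_support_append_iff, SimpleGraph.Walk.support_reverse,
      List.mem_reverse] at hy
    rcases hy with hy | hy
    · exact (hp y hy).trans hxs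
    · exact (hq y hy).trans hxs
  · refine (walkLength_le h _).trans ?_
    gcongr
    rw [walkUnits_append, walkUnits_reverse]
    have h1 := bound _ _ hx
    have h2 := bound _ _ hy
    exact_mod_cast (by omega : walkUnits k p + walkUnits k q ≤ 2 * Q)

open Finset Classical in
-- Double counting: the sets containing `e` have names in the output of a single vertex. This serves
-- both vertices and edges, the witness for an edge being one endpoint.
lemma sum_ncard_le {α : Type*} [Finite α] {n T : ℕ} (E : Set α) (N : Finset ℕ)
    (out : Fin n → Finset ℕ) (hout : ∀ v, #(out v) ≤ T) (F : ℕ → Set α)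
    (hFE : ∀ i, F i ⊆ E) (hF : ∀ e ∈ E, ∃ v, ∀ i, e ∈ F i → i ∈ out v) :
    ∑ i ∈ N, (F i).ncard ≤ T * E.ncard := by
  have := Fintype.ofFinite α
  have h1 : ∀ i, (F i).ncard = ∑ e ∈ E.toFinset, if e ∈ F i then 1 else 0 := by
    intro i
    rw [Set.ncard_eq_toFinset_card', ← Finset.card_filter]
    congr 1
    ext e
    simpa using fun h => hFE i h
  rw [sum_congr rfl fun i _ => h1 i, sum_comm, Set.ncard_eq_toFinset_card', mul_comm,
    ← smul_eq_mul]
  refine sum_le_card_nsmul _ _ _ fun e he => ?_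
  obtain ⟨v, hv⟩ := hF e (by simpa using he)
  rw [← Finset.card_filter]
  exact (card_le_card fun i hi => hv i (by simpa using (mem_filter.1 hi).2)).trans (hout v)

/-- If every vertex is padded in some phase, then the names of the clusters describe a pairwise
cover. -/
lemma outputsPairwiseCover {B Q R T ℓ : ℕ} {a f : Fin T → Fin n → ℕ} {δ W D S : ℝ}
    (hf : ∀ i, IsEnvelope G k B (a i) (f i)) (hk : ∀ e ∈ G.edgeSet, 0 < k e) (hB : 0 < B)
    (hinj : Function.Injective ident) (ha : ∀ i v, a i v % B = ident v)
    (hQ : ∀ i v, a i v < (Q + 1) * B) (hδ : 0 < δ) (h : ∀ e ∈ G.edgeSet, w e ≤ k e * δ)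
    (h' : ∀ e ∈ G.edgeSet, k e * δ ≤ w e + δ) (hW : W ≤ min ℓ n * δ) (hR : 4 * min ℓ n < R)
    (hpad : ∀ v, ∃ i, Padded G k B R (f i) v) (hD : 2 * Q * δ ≤ D) (hS : T ≤ S) :
    OutputsPairwiseCover G w ℓ (Set.Iic W) D S
      (fun v => Finset.univ.image fun i : Fin T => Nat.pair i (f i v % B)) := by
  set out : Fin n → Finset ℕ :=
    fun v => Finset.univ.image fun i : Fin T => Nat.pair i (f i v % B) with hout
  have hcard : ∀ v, (out v).card ≤ T := fun v => by
    simpa using Finset.card_image_le (s := Finset.univ)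
      (f := fun i : Fin T => Nat.pair i (f i v % B))
  have hmem : ∀ (i : Fin T) (v : Fin n) (s : ℕ), Nat.pair i s ∈ out v ↔ f i v % B = s := by
    intro i v s
    simp only [hout, Finset.mem_image, Finset.mem_univ, true_and, Nat.pair_eq_pair]
    constructor
    · rintro ⟨j, hj, rfl⟩
      rw [Fin.ext hj]
    · rintro rfl
      exact ⟨i, rfl, rfl⟩
  constructor
  · intro j hj
    obtain ⟨v, -, hv⟩ := Finset.mem_biUnion.1 hj
    obtain ⟨i, -, rfl⟩ := Finset.mem_image.1 hv
    have hC : cluster out (Nat.pair i (f i v % B)) = {x | f i x % B = f i v % B} := by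
      ext x
      exact hmem i x _
    rw [hC]
    intro x hx y hy
    obtain ⟨p, hp, hlen⟩ := (hf i).strongDiamLE hk hB hinj (ha i) (hQ i) hδ.le h x hx y hy
    exact ⟨p, hp, hlen.trans hD⟩
  · have := sum_ncard_le (Set.univ : Set (Fin n)) (clusterNames out) out hcard (cluster out)
      (fun _ => Set.subset_univ _) (fun v _ => ⟨v, fun i hi => hi⟩)
    rw [Set.ncard_univ, Nat.card_fin] at this
    calc ((∑ i ∈ clusterNames out, (cluster out i).ncard : ℕ) : ℝ) ≤ ((T * n : ℕ) : ℝ) := by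
          exact_mod_cast this
      _ ≤ S * n := by push_cast; gcongr
  · have := sum_ncard_le G.edgeSet (clusterNames out) out hcard
      (fun i => edgesInside G (cluster out i)) (fun i e he => he.1) (fun e he => by
        induction e with
        | _ x y => exact ⟨x, fun i hi => hi.2 x (Sym2.mem_mk_left x y)⟩)
    calc ((∑ i ∈ clusterNames out, (edgesInside G (cluster out i)).ncard : ℕ) : ℝ)
        ≤ ((T * G.edgeSet.ncard : ℕ) : ℝ) := by exact_mod_cast this
      _ ≤ S * G.edgeSet.ncard := by push_cast; gcongr
  · intro u v p hp hlen hpW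
    obtain ⟨i, hi⟩ := hpad u
    refine ⟨Nat.pair i (f i u % B), Finset.mem_biUnion.2 ⟨u, Finset.mem_univ _, ?_⟩, ?_⟩
    · exact (hmem i u _).2 rfl
    · intro x hx
      refine (hmem i x _).2 (hi x (p.takeUntil x hx) ?_)
      have h1 := walkUnits_takeUntil_le (k := k) p hx
      have h2 : p.length ≤ min ℓ n := le_min hlen (by simpa using hp.length_lt.le)
      -- Length `W` accounts for at most `min ℓ n` units, and rounding up adds at most one per edge.
      -- Doubling the total gives the requirement `4 * min ℓ n < R`.
      have h3 := walkUnits_le h' p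
      have h4 : (walkUnits k p : ℝ) * δ ≤ (2 * min ℓ n : ℕ) * δ := by
        have h5 : (p.length : ℝ) * δ ≤ (min ℓ n : ℕ) * δ := by gcongr
        have h6 : walkLength w p ≤ W := hpW
        push_cast at h5 hW ⊢
        linarith
      have h7 : walkUnits k p ≤ 2 * min ℓ n := by
        exact_mod_cast le_of_mul_le_mul_right h4 hδ
      omega

end

/-! ### Independent phases and the success probability. -/

open Finset Classical in
lemma one_sub_le_uniformOn_real {Ω : Type*} [Fintype Ω] [Nonempty Ω] [MeasurableSpace Ω]
    [MeasurableSingletonClass Ω] (S : Set Ω) (bad : Finset Ω) (hbad : ∀ ω, ω ∉ bad → ω ∈ S)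
    {N : ℕ} (hN : 0 < N) (h : #bad * N ≤ Fintype.card Ω) :
    1 - 1 / (N : ℝ) ≤ (ProbabilityTheory.uniformOn (Set.univ : Set Ω)).real S := by
  have hmono : (ProbabilityTheory.uniformOn (Set.univ : Set Ω)).real (bad : Set Ω)ᶜ ≤
      (ProbabilityTheory.uniformOn (Set.univ : Set Ω)).real S :=
    MeasureTheory.measureReal_mono (fun ω hω => hbad ω (by simpa using hω))
  refine le_trans ?_ hmono
  rw [MeasureTheory.probReal_compl_eq_one_sub bad.measurableSet, MeasureTheory.measureReal_def,
    ProbabilityTheory.uniformOn_univ, MeasureTheory.Measure.count_apply_finset, ENNReal.toReal_div,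
    ENNReal.toReal_natCast, ENNReal.toReal_natCast]
  have hpos : (0 : ℝ) < Fintype.card Ω := by exact_mod_cast Fintype.card_pos
  have hN' : (0 : ℝ) < N := by exact_mod_cast hN
  refine sub_le_sub_left ?_ 1
  rw [div_le_div_iff₀ hpos hN', one_mul]
  exact_mod_cast h

open Finset Classical in
/-- The probability that one of `n` events of probability at most `3 / 4` does not occur in any of
`T` independent trials. -/
lemma card_exists_forall_phaseCoins_le {n T m N : ℕ}
    (bad : Fin n → Finset (Fin n → Fin m → Bool))
    (hbad : ∀ v, 4 * #(bad v) ≤ 3 * Fintype.card (Fin n → Fin m → Bool))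
    (hT : n * N * 3 ^ T ≤ 4 ^ T) :
    #{ω : Fin n → Fin (T * m) → Bool | ∃ v, ∀ i, (fun u => phaseCoins (ω u) i) ∈ bad v} * N ≤
      Fintype.card (Fin n → Fin (T * m) → Bool) := by
  set X := Fintype.card (Fin n → Fin m → Bool) with hX
  have hcard : Fintype.card (Fin n → Fin (T * m) → Bool) = X ^ T := by
    simp only [hX, Fintype.card_fun, Fintype.card_bool, Fintype.card_fin, ← pow_mul]
    congr 1
    ring
  have hv : ∀ v, 4 ^ T *
      #{ω : Fin n → Fin (T * m) → Bool | ∀ i, (fun u => phaseCoins (ω u) i) ∈ bad v} ≤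
        3 ^ T * X ^ T := by
    intro v
    have h1 : #{ω : Fin n → Fin (T * m) → Bool | ∀ i, (fun u => phaseCoins (ω u) i) ∈ bad v} ≤
        #(Fintype.piFinset fun _ : Fin T => bad v) := by
      -- The phases use disjoint blocks of coins, so an outcome is a tuple of independent phase
      -- outcomes.
      refine card_le_card_of_injOn (fun ω i u => phaseCoins (ω u) i) ?_ ?_
      · intro ω hω
        simpa using hω
      · intro ω _ ω' _ heq
        funext u j
        obtain ⟨⟨i, j⟩, rfl⟩ := finProdFinEquiv.surjective j
        exact congrFun (congrFun (congrFun heq i) u) j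
    rw [Fintype.card_piFinset_const] at h1
    calc _ ≤ 4 ^ T * #(bad v) ^ T := by gcongr
      _ = (4 * #(bad v)) ^ T := (mul_pow _ _ _).symm
      _ ≤ (3 * X) ^ T := Nat.pow_le_pow_left (hbad v) T
      _ = _ := mul_pow _ _ _
  have hall : 4 ^ T * #{ω : Fin n → Fin (T * m) → Bool |
      ∃ v, ∀ i, (fun u => phaseCoins (ω u) i) ∈ bad v} ≤ n * (3 ^ T * X ^ T) := by
    calc _ ≤ 4 ^ T * ∑ v : Fin n,
          #{ω : Fin n → Fin (T * m) → Bool | ∀ i, (fun u => phaseCoins (ω u) i) ∈ bad v} := by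
          gcongr
          refine (card_le_card ?_).trans card_biUnion_le
          intro ω
          simp
      _ = ∑ v : Fin n, 4 ^ T *
          #{ω : Fin n → Fin (T * m) → Bool | ∀ i, (fun u => phaseCoins (ω u) i) ∈ bad v} :=
          mul_sum _ _ _
      _ ≤ ∑ v : Fin n, 3 ^ T * X ^ T := sum_le_sum fun v _ => hv v
      _ = _ := by simp
  rw [hcard]
  refine Nat.le_of_mul_le_mul_left ?_ (show 0 < 4 ^ T by positivity)
  calc _ = (4 ^ T * #{ω : Fin n → Fin (T * m) → Bool |
      ∃ v, ∀ i, (fun u => phaseCoins (ω u) i) ∈ bad v}) * N := by ring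
    _ ≤ n * (3 ^ T * X ^ T) * N := Nat.mul_le_mul_right _ hall
    _ = n * N * 3 ^ T * X ^ T := by ring
    _ ≤ 4 ^ T * X ^ T := Nat.mul_le_mul_right _ hT

lemma constructsCover_coverAlgorithm {a c n ℓ b T m R : ℕ} {W D S : ℝ} (hn : 1 ≤ n) (hℓ : 1 ≤ ℓ)
    (hW : 0 < W) (hm : n ≤ 2 ^ m) (hT : n ^ (c + 1) * 3 ^ T ≤ 4 ^ T)
    (hb : (R * (m + 1) + 1) * (n ^ a + 1) ≤ 2 ^ b) (hR : 4 * min ℓ n < R)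
    (hD : 2 * (R * (m + 1) : ℕ) * (W / (min ℓ n : ℕ)) ≤ D) (hS : T ≤ S) :
    ConstructsCover (coverAlgorithm b T (m + 1) R (n ^ a + 1) fun x => ⌈x / (W / (min ℓ n : ℕ))⌉₊)
      a c n ℓ (Set.Iic W) D S := by
  intro G w ident hw hinj hid
  set lam := min ℓ n with hlam
  have hlam0 : (0 : ℝ) < lam := by exact_mod_cast (lt_min hℓ hn : 0 < min ℓ n)
  set δ := W / (lam : ℝ) with hδdef
  have hδ : 0 < δ := div_pos hW hlam0
  set B := n ^ a + 1 with hBdef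
  have hB : 0 < B := Nat.succ_pos _
  have hident : ∀ v, ident v < B := fun v => Nat.lt_succ_of_le (hid v)
  set r : ℝ → ℕ := fun x => ⌈x / δ⌉₊ with hr
  set k : Sym2 (Fin n) → ℕ := fun e => r (w e) with hkdef
  have hk : ∀ e ∈ G.edgeSet, 0 < k e := fun e he => Nat.ceil_pos.2 (div_pos (hw e he) hδ)
  have h1 : ∀ e ∈ G.edgeSet, w e ≤ k e * δ := fun e he =>
    (div_le_iff₀ hδ).1 (Nat.le_ceil (w e / δ))
  have h2 : ∀ e ∈ G.edgeSet, k e * δ ≤ w e + δ := by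
    intro e he
    have h3 := (Nat.ceil_lt_add_one (div_pos (hw e he) hδ).le).le
    calc (k e : ℝ) * δ ≤ (w e / δ + 1) * δ := by gcongr
      _ = w e + δ := by field_simp
  let F : (Fin n → Fin (m + 1) → Bool) → Fin n → ℕ := fun η =>
    spread G k B (initialKey R B ident η) (R * (m + 1) + 1)
  have hF : ∀ η, IsEnvelope G k B (initialKey R B ident η) (F η) := fun η =>
    isEnvelope_spread hk (initialKey_lt ident hident η)
  classical
  have hbad := card_exists_forall_phaseCoins_le (T := T) (N := n ^ c)
    (fun v => {η : Fin n → Fin (m + 1) → Bool | ¬ Padded G k B R (F η) v})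
    (fun v => by
      convert card_not_padded_le hB (by omega) hk hinj hident (by simpa using hm) F hF v)
    (by rw [← pow_succ']; exact hT)
  have hmain := one_sub_le_uniformOn_real
    {ω : Fin n → Fin (T * (m + 1)) → Bool | OutputsPairwiseCover G w ℓ (Set.Iic W) D S
      (run G w ident (coverAlgorithm b T (m + 1) R B r) ω)} _ ?_ (Nat.pow_pos hn) hbad
  · rw [Nat.cast_pow] at hmain
    exact hmain
  · intro ω hω
    simp only [Finset.mem_filter, Finset.mem_univ, true_and, not_exists, not_forall,
      not_not] at hω
    change OutputsPairwiseCover G w ℓ (Set.Iic W) D S _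
    rw [funext fun v => run_coverAlgorithm G w ident r hinj hident hb ω v]
    refine outputsPairwiseCover (k := k) (Q := R * (m + 1)) (δ := δ) (R := R)
      (fun i => hF fun u => phaseCoins (ω u) i) hk hB hinj
      (fun i v => initialKey_mod hident _ v) (fun i v => initialKey_lt ident hident _ v)
      hδ h1 h2 ?_ hR hω hD hS
    rw [← hlam, hδdef, mul_div_cancel₀ _ hlam0.ne']

/-! ### Choice of parameters and asymptotic bounds. -/

lemma clog_le_three_mul_log {n : ℕ} (hn : 2 ≤ n) : (Nat.clog 2 n : ℝ) ≤ 3 * Real.log n := by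
  have h2 := Real.log_two_gt_d9
  have h1 : 2 ^ (Nat.clog 2 n - 1) < n := Nat.pow_pred_clog_lt_self one_lt_two hn
  have h0 : 0 < Nat.clog 2 n := Nat.clog_pos one_lt_two hn
  have h3 : Real.log ((2 : ℝ) ^ (Nat.clog 2 n - 1)) ≤ Real.log n :=
    Real.log_le_log (by positivity) (by exact_mod_cast h1.le)
  have h4 : Real.log 2 ≤ Real.log n := Real.log_le_log (by norm_num) (by exact_mod_cast hn)
  rw [Real.log_pow, Nat.cast_sub h0, Nat.cast_one] at h3
  nlinarith

/-- A family of algorithms that construct covers for the paths of length at most `W` in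
`O(ℓ * log n ^ 2)` rounds. -/
lemma exists_constructsCover_Iic (a c : ℕ) :
    ∃ (K : ℝ) (A : ℕ → ℕ → ℝ → Algorithm (Finset ℕ)), 0 ≤ K ∧
      ∀ (n ℓ : ℕ) (W : ℝ), 2 ≤ n → 1 ≤ ℓ → 0 < W →
        ((A n ℓ W).bandwidth : ℝ) ≤ K * Real.log n ∧
        ((A n ℓ W).rounds : ℝ) ≤ K * (ℓ * Real.log n ^ 2) ∧
        ∀ D S : ℝ, K * (W * Real.log n) ≤ D → K * Real.log n ≤ S →
          ConstructsCover (A n ℓ W) a c n ℓ (Set.Iic W) D S := by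
  -- The cap `min ℓ n` is harmless because simple paths have fewer than `n` edges; it keeps the
  -- bandwidth independent of `ℓ`. The constant `1000` is generous.
  refine ⟨1000 * (a + 1) * (c + 1), fun n ℓ W => coverAlgorithm (5 + Nat.clog 2 n * (a + 2))
    (3 * ((c + 1) * Nat.clog 2 n)) (Nat.clog 2 n + 1) (4 * min ℓ n + 1) (n ^ a + 1)
    fun x => ⌈x / (W / (min ℓ n : ℕ))⌉₊, by positivity, ?_⟩
  intro n ℓ W hn hℓ hW
  beta_reduce
  have hL := clog_le_three_mul_log hn
  have hL1 : 1 ≤ Nat.clog 2 n := Nat.clog_pos one_lt_two hn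
  have hnL : n ≤ 2 ^ Nat.clog 2 n := Nat.le_pow_clog one_lt_two n
  have hLn : Nat.clog 2 n ≤ n := Nat.clog_le_of_le_pow Nat.lt_two_pow_self.le
  generalize Nat.clog 2 n = L at *
  have hL1' : (1 : ℝ) ≤ L := by exact_mod_cast hL1
  have ha0 : (0 : ℝ) ≤ a := a.cast_nonneg
  have hc0 : (0 : ℝ) ≤ c := c.cast_nonneg
  set x := Real.log n with hx
  have hx0 : 0 < x := by linarith
  have hlam : 1 ≤ min ℓ n := le_min hℓ (by omega)
  refine ⟨?_, ?_, ?_⟩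
  · change ((5 + L * (a + 2) : ℕ) : ℝ) ≤ _
    push_cast
    have h1 : 5 + (L : ℝ) * (a + 2) ≤ L * (7 * (a + 1)) := by nlinarith
    have h2 : (L : ℝ) * (7 * (a + 1)) ≤ 3 * x * (7 * (a + 1)) := by gcongr
    have h3 : (0 : ℝ) ≤ x * (a + 1) := by positivity
    have h4 : (0 : ℝ) ≤ x * (a + 1) * c := by positivity
    linarith
  · change ((3 * ((c + 1) * L) * ((4 * min ℓ n + 1) * (L + 1) + 1) : ℕ) : ℝ) ≤ _
    have h1 : (4 * min ℓ n + 1) * (L + 1) + 1 ≤ 11 * (ℓ * L) := by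
      have h2 : 4 * min ℓ n + 1 ≤ 5 * ℓ := by omega
      have h3 : 1 ≤ ℓ * L := Nat.mul_pos hℓ hL1
      calc _ ≤ 5 * ℓ * (L + L) + ℓ * L := by gcongr
        _ = _ := by ring
    calc ((3 * ((c + 1) * L) * ((4 * min ℓ n + 1) * (L + 1) + 1) : ℕ) : ℝ)
        ≤ ((3 * ((c + 1) * L) * (11 * (ℓ * L)) : ℕ) : ℝ) := by
          exact_mod_cast Nat.mul_le_mul_left _ h1
      _ = 33 * (c + 1) * ℓ * (L : ℝ) ^ 2 := by push_cast; ring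
      _ ≤ 33 * (c + 1) * ℓ * (3 * x) ^ 2 := by gcongr
      _ ≤ 1000 * (a + 1) * (c + 1) * (ℓ * x ^ 2) := by
        have h3 : (0 : ℝ) ≤ (c + 1) * ℓ * x ^ 2 := by positivity
        have h4 : (0 : ℝ) ≤ a * ((c + 1) * ℓ * x ^ 2) := by positivity
        linarith
  · intro D S hD hS
    refine constructsCover_coverAlgorithm (by omega) hℓ hW hnL ?_ ?_ (by omega)
      (le_trans ?_ hD) (le_trans ?_ hS)
    -- One factor `n` pays for the union bound over vertices, `n ^ c` for the failure probability.
    -- Three phases per unit of `(c + 1) * L` suffice since `2 * 3 ^ 3 = 54 ≤ 4 ^ 3`.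
    · calc n ^ (c + 1) * 3 ^ (3 * ((c + 1) * L))
          ≤ (2 ^ L) ^ (c + 1) * 3 ^ (3 * ((c + 1) * L)) := by gcongr
        _ = 54 ^ ((c + 1) * L) := by
          rw [← pow_mul, mul_comm L, pow_mul 3 3, ← mul_pow]
          norm_num
        _ ≤ 64 ^ ((c + 1) * L) := by gcongr; norm_num
        _ = 4 ^ (3 * ((c + 1) * L)) := by rw [pow_mul 4 3]; norm_num
    · have h1 : (4 * min ℓ n + 1) * (L + 1) + 1 ≤ 16 * n ^ 2 := by
        calc _ ≤ (4 * n + n) * (n + n) + n * n := by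
              gcongr
              · exact min_le_right _ _
              · omega
              · omega
              · nlinarith
          _ = 11 * n ^ 2 := by ring
          _ ≤ 16 * n ^ 2 := by gcongr; norm_num
      have h2 : n ^ a + 1 ≤ 2 * n ^ a := by
        have := Nat.one_le_pow a n (by omega)
        omega
      calc _ ≤ 16 * n ^ 2 * (2 * n ^ a) := Nat.mul_le_mul h1 h2
        _ = 2 ^ 5 * n ^ (a + 2) := by ring
        _ ≤ 2 ^ 5 * (2 ^ L) ^ (a + 2) := by gcongr
        _ = _ := by rw [← pow_mul, ← pow_add]
    · have hl : (1 : ℝ) ≤ (min ℓ n : ℕ) := by exact_mod_cast hlam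
      generalize min ℓ n = lam at *
      have hl0 : (0 : ℝ) < lam := by linarith
      push_cast
      calc 2 * ((4 * (lam : ℝ) + 1) * (L + 1)) * (W / lam)
          ≤ 2 * ((5 * lam) * (2 * L)) * (W / lam) := by
            gcongr <;> linarith
        _ = 20 * W * L := by field_simp; ring
        _ ≤ 20 * W * (3 * x) := by gcongr
        _ ≤ 1000 * (a + 1) * (c + 1) * (W * x) := by
          have h3 : (0 : ℝ) ≤ W * x := by positivity
          have h4 : (0 : ℝ) ≤ (a + c + a * c) * (W * x) := by positivity
          linarith
    · push_cast
      have h1 : 3 * (((c : ℝ) + 1) * L) ≤ 3 * ((c + 1) * (3 * x)) := by gcongr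
      have h3 : (0 : ℝ) ≤ (c + 1) * x := by positivity
      have h4 : (0 : ℝ) ≤ a * ((c + 1) * x) := by positivity
      linarith

lemma ConstructsCover.mono {A : Algorithm (Finset ℕ)} {a c n ℓ : ℕ} {L L' : Set ℝ} {D S : ℝ}
    (h : ConstructsCover A a c n ℓ L D S) (hL : L' ⊆ L) : ConstructsCover A a c n ℓ L' D S := by
  intro G w ident hw hinj hid
  refine (h G w ident hw hinj hid).trans (MeasureTheory.measureReal_mono fun ω hω => ?_)
  exact ⟨hω.diam_le, hω.sum_card_le, hω.sum_edges_le,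
    fun u v p hp hlen hp' => hω.path_subset u v p hp hlen (hL hp')⟩

end Congest

theorem mainTheorem2 (a c : ℕ) :
    (∃ (K : ℝ) (A : ℕ → ℕ → ℝ → Congest.Algorithm (Finset ℕ)),
      ∀ (n ℓ : ℕ) (W : ℝ), 2 ≤ n → 1 ≤ ℓ → 2 ≤ W →
        ((A n ℓ W).bandwidth : ℝ) ≤ K * Real.log n ∧
        ((A n ℓ W).rounds : ℝ) ≤ K * (ℓ * Real.log n ^ 2 * Real.log W) ∧
        Congest.ConstructsCover (A n ℓ W) a c n ℓ (Set.Iic W)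
          (K * (W * Real.log n)) (K * Real.log n)) ∧
    (∃ (K : ℝ) (A : ℕ → ℕ → ℝ → Congest.Algorithm (Finset ℕ)),
      ∀ (n ℓ : ℕ) (W : ℝ), 2 ≤ n → 1 ≤ ℓ → 0 < W →
        ((A n ℓ W).bandwidth : ℝ) ≤ K * Real.log n ∧
        ((A n ℓ W).rounds : ℝ) ≤ K * (ℓ * Real.log n ^ 2) ∧
        Congest.ConstructsCover (A n ℓ W) a c n ℓ (Set.Icc W (2 * W))
          (K * (W * Real.log n)) (K * Real.log n)) := by
  obtain ⟨K, A, hK, hA⟩ := Congest.exists_constructsCover_Iic a c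
  -- In the first part the factor `2` compensates for `log W ≥ 1 / 2`; in the second it absorbs the
  -- passage from `W` to `2 * W`.
  refine ⟨⟨2 * K, A, fun n ℓ W hn hℓ hW => ?_⟩,
    ⟨2 * K, fun n ℓ W => A n ℓ (2 * W), fun n ℓ W hn hℓ hW => ?_⟩⟩
  · obtain ⟨h1, h2, h3⟩ := hA n ℓ W hn hℓ (by linarith)
    have hlog : 0 ≤ Real.log n := Real.log_natCast_nonneg n
    have hKlog : K * Real.log n ≤ 2 * K * Real.log n := by gcongr; linarith
    refine ⟨h1.trans hKlog, h2.trans ?_, h3 _ _ (by gcongr; linarith) hKlog⟩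
    have hlogW : 1 / 2 ≤ Real.log W := by
      have := Real.log_two_gt_d9
      have := Real.log_le_log (by norm_num) hW
      linarith
    calc K * (ℓ * Real.log n ^ 2) = 2 * K * (ℓ * Real.log n ^ 2 * (1 / 2)) := by ring
      _ ≤ 2 * K * (ℓ * Real.log n ^ 2 * Real.log W) := by gcongr
  · obtain ⟨h1, h2, h3⟩ := hA n ℓ (2 * W) hn hℓ (by linarith)
    have hlog : 0 ≤ Real.log n := Real.log_natCast_nonneg n
    have hKlog : K * Real.log n ≤ 2 * K * Real.log n := by gcongr; linarith
    refine ⟨h1.trans hKlog, h2.trans (by gcongr; linarith), ?_⟩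
    exact (h3 _ _ (le_of_eq (by ring)) hKlog).mono fun y hy => hy.2
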